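/- Let $V$ be a finite set and let $w : V \to \mathbb{R}_{\ge 0}$ be an arbitrary non-negative weight function; write $w(T)=\sum_{x\in T} w(x)$. **Instances.** An influence instance over $N\subseteq V$ is a triple $\mathcal I=(N,E,P_{\mathcal I})$, where $(N,E)$ is a directed graph and $P_{\mathcal I}:2^N\times 2^N\to[0,1]$ satisfies $\sum_{T\subseteq N}P_{\mathcal I}(S,T)=1$ for every $S\subseteq N$, $P_{\mathcal I}(\emptyset,\emptyset)=1$, and $P_{\mathcal I}(S,T)=0$ whenever $S\not\subseteq T$ ($P_{\mathcal I}(S,T)$ is the probability that the seed set $S$ activates exactly $T$). A centrality measure $\psi$ assigns to every influence instance $\mathcal I$ over every $N\subseteq V$ a vector $(\psi_v(\mathcal I))_{v\in N}\in\mathbb{R}^N$; an instance enters only through $N$ and its influence profile $P_{\mathcal I}$, i.e. $\psi(\mathcal I)=\psi(\mathcal J)$ if $\mathcal I,\mathcal J$ are over the same $N$ and $P_{\mathcal I}=P_{\mathcal J}$. **Sink nodes and projection.** A node $v\in N$ is a sink node of $\mathcal I$ if $P_{\mathcal I}(S\cup\{v\},T\cup\{v\})=P_{\mathcal I}(S,T)+P_{\mathcal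 I}(S,T\cup\{v\})$ for all $S,T\subseteq N\setminus\{v\}$. The projection $\mathcal I\setminus\{v\}$ is the instance over $N\setminus\{v\}$ whose edges are the edges of $\mathcal I$ not incident to $v$ and with $P_{\mathcal I\setminus\{v\}}(S,T)=P_{\mathcal I}(S,T)+P_{\mathcal I}(S,T\cup\{v\})$. **Axioms $\mathcal A^w$** (for all instances over all $N\subseteq V$): 1. (Weighted Normalization) $\sum_{v\in N}\psi_v(\mathcal I)=w(N)$. 2. (Independence of Sink Nodes) If $u\ne v$ are sink nodes of $\mathcal I$, then $\psi_u(\mathcal I)=\psi_u(\mathcal I\setminus\{v\})$. 3. (Bayesian Influence) If $\mathcal I^1,\dots,\mathcal I^r$ are instances on the same graph $(N,E)$, $\lambda_\eta\ge 0$, $\sum_\eta\lambda_\eta=1$, and $\mathcal I$ is the instance on $(N,E)$ with $P_{\mathcal I}=\sum_\eta\lambda_\eta P_{\mathcal I^\eta}$, then $\psi_v(\mathcal I)=\sum_\eta\lambda_\eta\psi_v(\mathcal I^\eta)$ for all $v\in N$. 4. (Weighted Bargaining with Critical Sets) Let $\emptyset\neq R\subseteq V$, $v\in V\setminus R$, and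 let $\mathcal I$ be an instance over $N=R\cup\{v\}$ whose graph contains all edges from $R$ to $v$, with $P_{\mathcal I}(S,N)=1$ for $R\subseteq S\subseteq N$ and $P_{\mathcal I}(S,S)=1$ for $S\subseteq N$, $R\not\subseteq S$. Then $\psi_v(\mathcal I)=\frac{|R|\,w(v)}{|R|+1}$. 5. (Weighted Node Symmetry) Let $D$ be the set of sink nodes of $\mathcal I$. If for every pair $a,b\in N\setminus D$ the transposition $\pi_{ab}$ satisfies $P_{\mathcal I}(S,T)=P_{\mathcal I}(\pi_{ab}(S),\pi_{ab}(T))$ for all $S,T\subseteq N$, then for all $v\in D$ and $u\in N\setminus D$: $\psi_u(\mathcal I)=\psi_u(\mathcal I\setminus\{v\})+\frac{1}{|N\setminus D|}\bigl(w(v)-\psi_v(\mathcal I)\bigr)$. **Weighted Shapley centrality.** Put $\sigma^w_{\mathcal I}(S)=\sum_{S\subseteq T\subseteq N}P_{\mathcal I}(S,T)\,w(T)$ and $$\psi^{w,\mathrm{Shapley}}_v(\mathcal I)=\sum_{S\subseteq N\setminus\{v\}}\frac{|S|!\,(|N|-|S|-1)!}{|N|!}\bigl(\sigma^w_{\mathcal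 I}(S\cup\{v\})-\sigma^w_{\mathcal I}(S)\bigr),\qquad v\in N.$$ **Theorem.** A centrality measure $\psi$ satisfies all axioms in $\mathcal A^w$ if and only if $\psi=\psi^{w,\mathrm{Shapley}}$. -/

import Mathlib

namespace SocialInfluence

/-- An influence instance `(N, E, P)` whose node set `N` is a finite subset of the ground set `V`.
`prob S T` is the probability that the seed set `S ⊆ N` activates exactly the set `T ⊆ N`.
The function `prob` on pairs of subsets of `N` is stored as its extension by zero. -/
structure Instance (V : Type*) (N : Finset V) where
  edges : Set (V × V)
  edges_mem : ∀ a b, (a, b) ∈ edges → a ∈ N ∧ b ∈ N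
  prob : Finset V → Finset V → ℝ
  prob_off : ∀ S T, ¬ (S ⊆ N ∧ T ⊆ N) → prob S T = 0
  prob_nonneg : ∀ S T, 0 ≤ prob S T
  prob_sum : ∀ S, S ⊆ N → ∑ T ∈ N.powerset, prob S T = 1
  prob_empty_empty : prob ∅ ∅ = 1
  prob_empty : ∀ T, T ≠ ∅ → prob ∅ T = 0
  prob_progressive : ∀ S T, ¬ S ⊆ T → prob S T = 0

variable {V : Type*} [DecidableEq V] {N : Finset V}

namespace Instance

/-- `v` is a sink node of `I`. -/
def IsSink (I : Instance V N) (v : V) : Prop :=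
  v ∈ N ∧ ∀ S T : Finset V, S ⊆ N.erase v → T ⊆ N.erase v →
    I.prob (insert v S) (insert v T) = I.prob S T + I.prob S (insert v T)

/-- The projected instance `I ∖ {v}` over the node set `N ∖ {v}`. -/
def project (I : Instance V N) (v : V) (hv : v ∈ N) : Instance V (N.erase v) where
  edges := {e | e ∈ I.edges ∧ e.1 ≠ v ∧ e.2 ≠ v}
  edges_mem := by
    intro a b h
    have := I.edges_mem a b h.1
    exact ⟨Finset.mem_erase.2 ⟨h.2.1, this.1⟩, Finset.mem_erase.2 ⟨h.2.2, this.2⟩⟩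
  prob S T := if S ⊆ N.erase v ∧ T ⊆ N.erase v then I.prob S T + I.prob S (insert v T) else 0
  prob_off := fun S T h => if_neg h
  prob_nonneg := by
    intro S T
    split_ifs
    · exact add_nonneg (I.prob_nonneg _ _) (I.prob_nonneg _ _)
    · exact le_rfl
  prob_sum := by
    intro S hS
    have h1 := I.prob_sum S (hS.trans (Finset.erase_subset _ _))
    have h2 : N.powerset = (insert v (N.erase v)).powerset := by rw [Finset.insert_erase hv]
    rw [h2, Finset.sum_powerset_insert (Finset.notMem_erase v N)] at h1
    rw [← h1, ← Finset.sum_add_distrib]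
    refine Finset.sum_congr rfl fun T hT => ?_
    rw [if_pos ⟨hS, Finset.mem_powerset.1 hT⟩]
  prob_empty_empty := by
    rw [if_pos ⟨Finset.empty_subset _, Finset.empty_subset _⟩, I.prob_empty_empty,
      I.prob_empty _ (Finset.insert_ne_empty _ _), add_zero]
  prob_empty := by
    intro T hT
    split_ifs
    · rw [I.prob_empty _ hT, I.prob_empty _ (Finset.insert_ne_empty _ _), add_zero]
    · rfl
  prob_progressive := by
    intro S T h
    split_ifs with hST
    · have hv' : v ∉ S := fun hvS => Finset.notMem_erase v N (hST.1 hvS)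
      have h' : ¬ S ⊆ insert v T := fun hs => h ((Finset.subset_insert_iff_of_notMem hv').1 hs)
      rw [I.prob_progressive _ _ h, I.prob_progressive _ _ h', add_zero]
    · rfl

/-- The Bayesian instance of `r` instances on one common network `(N, E)` for the prior `p`. -/
def bayesian {r : ℕ} (E : Set (V × V)) (I : Fin r → Instance V N)
    (hE : ∀ i, (I i).edges = E) (p : Fin r → ℝ) (hp : ∀ i, 0 ≤ p i) (hp1 : ∑ i, p i = 1) :
    Instance V N where
  edges := E
  edges_mem := by
    intro a b h
    rcases Nat.eq_zero_or_pos r with h0 | h0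
    · subst h0
      simp at hp1
    · exact (I ⟨0, h0⟩).edges_mem a b (by rw [hE]; exact h)
  prob S T := ∑ i, p i * (I i).prob S T
  prob_off := fun S T h => Finset.sum_eq_zero fun i _ => by rw [(I i).prob_off S T h, mul_zero]
  prob_nonneg := fun S T =>
    Finset.sum_nonneg fun i _ => mul_nonneg (hp i) ((I i).prob_nonneg S T)
  prob_sum := by
    intro S hS
    rw [Finset.sum_comm, ← hp1]
    refine Finset.sum_congr rfl fun i _ => ?_
    rw [← Finset.mul_sum, (I i).prob_sum S hS, mul_one]
  prob_empty_empty := by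
    rw [← hp1]
    exact Finset.sum_congr rfl fun i _ => by rw [(I i).prob_empty_empty, mul_one]
  prob_empty := fun T hT => Finset.sum_eq_zero fun i _ => by rw [(I i).prob_empty T hT, mul_zero]
  prob_progressive := fun S T h =>
    Finset.sum_eq_zero fun i _ => by rw [(I i).prob_progressive S T h, mul_zero]

/-- `I` is a critical set instance with critical set `R` and target set `U`: its network contains
a complete directed bipartite graph from `R` to `U ∖ R`, the nodes outside `U` are isolated, every
seed set containing `R` activates exactly `U` and itself, every other seed set only itself. -/
structure IsCriticalSet (I : Instance V N) (R U : Finset V) : Prop where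
  nonempty : R.Nonempty
  subset : R ⊆ U
  subset_nodes : U ⊆ N
  bipartite : ∀ a ∈ R, ∀ b ∈ U \ R, (a, b) ∈ I.edges
  isolated : ∀ e ∈ I.edges, e.1 ∈ U ∧ e.2 ∈ U
  active : ∀ S : Finset V, S ⊆ N → R ⊆ S → I.prob S (U ∪ S) = 1
  inactive : ∀ S : Finset V, S ⊆ N → ¬ R ⊆ S → I.prob S S = 1

/-- The node pair `a, b` is symmetric in `I`: swapping `a` and `b` preserves the influence
profile. -/
def IsSymmPair (I : Instance V N) (a b : V) : Prop :=
  ∀ S T : Finset V, S ⊆ N → T ⊆ N →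
    I.prob S T = I.prob (S.image (Equiv.swap a b)) (T.image (Equiv.swap a b))

/-- The weighted influence spread `σ^w(S) = ∑_{S ⊆ T ⊆ N} P(S, T) w(T)`. -/
def spread (I : Instance V N) (w : V → ℝ) (S : Finset V) : ℝ :=
  ∑ T ∈ N.powerset with S ⊆ T, I.prob S T * ∑ x ∈ T, w x

end Instance

/-- The Shapley value of the player `v` in the coalitional game `τ` with player set `N`. -/
noncomputable def shapleyValue (N : Finset V) (τ : Finset V → ℝ) (v : V) : ℝ :=
  ∑ S ∈ (N.erase v).powerset,
    ((S.card.factorial * (N.card - S.card - 1).factorial : ℕ) : ℝ) / (N.card.factorial : ℝ) *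
      (τ (insert v S) - τ S)

/-- An influence-based centrality measure: it assigns to every influence instance over every
`N ⊆ V` a real vector indexed by `N`. An instance enters only through its node set and its
influence profile, that is, two instances with the same profile are not distinguished. -/
@[ext]
structure CentralityMeasure (V : Type*) where
  value : ∀ {N : Finset V}, Instance V N → N → ℝ
  value_eq : ∀ {N : Finset V} (I J : Instance V N), I.prob = J.prob → value I = value J

/-- The weighted Shapley centrality: the Shapley value of the weighted influence spread. -/
noncomputable def weightedShapley (w : V → ℝ) : CentralityMeasure V where
  value {N} I v := shapleyValue N (I.spread w) v
  value_eq := by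
    intro N I J h
    funext v
    simp only [shapleyValue, Instance.spread, h]

open Classical in
/-- The axiom set parametrized by the node weight function `w`. -/
structure SatisfiesAxioms (w : V → ℝ) (ψ : CentralityMeasure V) : Prop where
  /-- Weighted Normalization. -/
  normalization : ∀ (N : Finset V) (I : Instance V N), ∑ v : N, ψ.value I v = ∑ v ∈ N, w v
  /-- Independence of Sink Nodes. -/
  sink : ∀ (N : Finset V) (I : Instance V N) (u v : V) (hu : u ∈ N) (hv : v ∈ N) (huv : u ≠ v),
    I.IsSink u → I.IsSink v →
      ψ.value I ⟨u, hu⟩ = ψ.value (I.project v hv) ⟨u, Finset.mem_erase.2 ⟨huv, hu⟩⟩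
  /-- Bayesian Influence. -/
  bayesian : ∀ (N : Finset V) (r : ℕ) (E : Set (V × V)) (I : Fin r → Instance V N)
    (hE : ∀ i, (I i).edges = E) (p : Fin r → ℝ) (hp : ∀ i, 0 ≤ p i) (hp1 : ∑ i, p i = 1) (v : N),
      ψ.value (Instance.bayesian E I hE p hp hp1) v = ∑ i, p i * ψ.value (I i) v
  /-- Weighted Bargaining with Critical Sets. -/
  critical : ∀ (R : Finset V) (v : V), v ∉ R → ∀ I : Instance V (insert v R),
    I.IsCriticalSet R (insert v R) →
      ψ.value I ⟨v, Finset.mem_insert_self v R⟩ = (R.card : ℝ) * w v / ((R.card : ℝ) + 1)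
  /-- Weighted Node Symmetry. -/
  symmetry : ∀ (N : Finset V) (I : Instance V N),
    (∀ a ∈ N, ∀ b ∈ N, ¬ I.IsSink a → ¬ I.IsSink b → I.IsSymmPair a b) →
    ∀ (u v : V) (hu : u ∈ N) (hv : v ∈ N) (huv : u ≠ v), ¬ I.IsSink u → I.IsSink v →
      ψ.value I ⟨u, hu⟩ =
        ψ.value (I.project v hv) ⟨u, Finset.mem_erase.2 ⟨huv, hu⟩⟩ +
          1 / ((N.filter fun x => ¬ I.IsSink x).card : ℝ) * (w v - ψ.value I ⟨v, hv⟩)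

end SocialInfluence

/-! Existence. The weighted spread is `∑ x, w x * act x`, where `act x S` is the probability that
`S` activates `x`, so by linearity only the Shapley values of the single-target games `act x`
matter. A sink `v` is a null player in `act x` for every `x ≠ v`, and projecting `v` away leaves
these games unchanged for the other players. Hence projection costs `u` exactly the term `w v *
shapleyValue N (I.act v) u`, which gives both sink axioms.

Uniqueness. On a critical set instance the axioms determine the value by induction on the number of
nodes: sinks are projected away, bargaining settles the last sink, and symmetry settles the critical
set. The Bayesian axiom makes the difference of two such measures linear in the profile, with
coefficients their differences on elementary instances, where one set `S` activates `T` and every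
other set only itself. A critical set instance expands into elementary ones with strictly larger
seed sets plus the elementary instance of `(S, T)` itself, so downward induction on the seed set
finishes (`value_elementary`). -/

namespace SocialInfluence

variable {V : Type*} [DecidableEq V] {N : Finset V}

/-! ### The Shapley value -/

/-- The weight of a coalition of size `s` in the Shapley value with `n` players. -/
noncomputable def shapleyWeight (n s : ℕ) : ℝ :=
  ((s.factorial * (n - s - 1).factorial : ℕ) : ℝ) / (n.factorial : ℝ)

theorem shapleyValue_eq (τ : Finset V → ℝ) (v : V) :
    shapleyValue N τ v =
      ∑ S ∈ (N.erase v).powerset, shapleyWeight N.card S.card * (τ (insert v S) - τ S) := rfl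

/-- In a random order of `n + 1` players, forgetting one player merges the predecessor sets with and
without it. -/
theorem shapleyWeight_pascal {n s : ℕ} (h : s + 1 ≤ n) :
    shapleyWeight (n + 1) s + shapleyWeight (n + 1) (s + 1) = shapleyWeight n s := by
  obtain ⟨k, rfl⟩ := Nat.exists_eq_add_of_le h
  have e1 : s + 1 + k + 1 - s - 1 = k + 1 := by omega
  have e2 : s + 1 + k + 1 - (s + 1) - 1 = k := by omega
  have e3 : s + 1 + k - s - 1 = k := by omega
  have hf : ((s + 1 + k).factorial : ℝ) ≠ 0 := by positivity
  have hn : ((s + 1 + k + 1 : ℕ) : ℝ) ≠ 0 := by positivity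
  rw [shapleyWeight, shapleyWeight, shapleyWeight, e1, e2, e3, Nat.factorial_succ (s + 1 + k),
    Nat.factorial_succ k, Nat.factorial_succ s]
  push_cast at hn ⊢
  field_simp
  ring

/-- Both sides are `t! (n - t)! / n!`. In the efficiency sum this cancels every coalition other than
`∅` and `N`. -/
theorem mul_shapleyWeight_pred {n t : ℕ} (h0 : t ≠ 0) (hn : t < n) :
    (t : ℝ) * shapleyWeight n (t - 1) = ((n - t : ℕ) : ℝ) * shapleyWeight n t := by
  obtain ⟨s, rfl⟩ := Nat.exists_eq_succ_of_ne_zero h0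
  obtain ⟨k, rfl⟩ := Nat.exists_eq_add_of_le (Nat.succ_le_of_lt hn)
  simp only [Nat.succ_eq_add_one, Nat.add_sub_cancel]
  have e1 : s + 1 + 1 + k - s - 1 = k + 1 := by omega
  have e2 : s + 1 + 1 + k - (s + 1) - 1 = k := by omega
  have e3 : s + 1 + 1 + k - (s + 1) = k + 1 := by omega
  rw [shapleyWeight, shapleyWeight, e1, e2, e3, Nat.factorial_succ k, Nat.factorial_succ s]
  push_cast
  ring

theorem shapleyValue_congr {τ τ' : Finset V → ℝ} {v : V}
    (h : ∀ S ⊆ N.erase v, τ (insert v S) - τ S = τ' (insert v S) - τ' S) :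
    shapleyValue N τ v = shapleyValue N τ' v := by
  rw [shapleyValue_eq, shapleyValue_eq]
  exact Finset.sum_congr rfl fun S hS => by rw [h S (Finset.mem_powerset.1 hS)]

theorem shapleyValue_eq_zero {τ : Finset V → ℝ} {v : V}
    (h : ∀ S ⊆ N.erase v, τ (insert v S) = τ S) : shapleyValue N τ v = 0 := by
  rw [shapleyValue_eq]
  exact Finset.sum_eq_zero fun S hS => by
    rw [h S (Finset.mem_powerset.1 hS), sub_self, mul_zero]

theorem shapleyValue_sum {ι : Type*} (s : Finset ι) (c : ι → ℝ) (τ : ι → Finset V → ℝ) (v : V) :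
    shapleyValue N (fun S => ∑ i ∈ s, c i * τ i S) v = ∑ i ∈ s, c i * shapleyValue N (τ i) v := by
  simp only [shapleyValue_eq, Finset.mul_sum]
  rw [Finset.sum_comm]
  refine Finset.sum_congr rfl fun S _ => ?_
  rw [← Finset.sum_sub_distrib, Finset.mul_sum]
  exact Finset.sum_congr rfl fun i _ => by ring

/-- The Shapley value is efficient. -/
theorem sum_shapleyValue (τ : Finset V → ℝ) : ∑ v ∈ N, shapleyValue N τ v = τ N - τ ∅ := by
  rcases N.eq_empty_or_nonempty with rfl | hN
  · simp
  have hn : N.card ≠ 0 := Finset.card_ne_zero.2 hN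
  have hf : ((N.card - 1).factorial : ℝ) ≠ 0 := by positivity
  have hc : (N.card : ℝ) ≠ 0 := by exact_mod_cast hn
  have hfac : (N.card.factorial : ℝ) = N.card * (N.card - 1).factorial := by
    rw [← Nat.cast_mul, Nat.mul_factorial_pred hn]
  -- Regroup by `T = insert v S`: each `T` arises once for each of its elements.
  have hA : ∑ v ∈ N, ∑ S ∈ (N.erase v).powerset, shapleyWeight N.card S.card * τ (insert v S) =
      ∑ T ∈ N.powerset, (T.card : ℝ) * shapleyWeight N.card (T.card - 1) * τ T := by
    have : ∀ T ∈ N.powerset, (T.card : ℝ) * shapleyWeight N.card (T.card - 1) * τ T =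
        ∑ _v ∈ T, shapleyWeight N.card (T.card - 1) * τ T := by
      intro T _
      rw [Finset.sum_const, nsmul_eq_mul, mul_assoc]
    rw [Finset.sum_congr rfl this, Finset.sum_sigma', Finset.sum_sigma']
    refine Finset.sum_bij' (fun x _ => ⟨insert x.1 x.2, x.1⟩) (fun x _ => ⟨x.2, x.1.erase x.2⟩)
      ?_ ?_ ?_ ?_ ?_
    · rintro ⟨v, S⟩ h
      simp only [Finset.mem_sigma, Finset.mem_powerset] at h ⊢
      exact ⟨Finset.insert_subset h.1 (h.2.trans (Finset.erase_subset _ _)),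
        Finset.mem_insert_self _ _⟩
    · rintro ⟨T, v⟩ h
      simp only [Finset.mem_sigma, Finset.mem_powerset] at h ⊢
      exact ⟨h.1 h.2, Finset.erase_subset_erase _ h.1⟩
    · rintro ⟨v, S⟩ h
      simp only [Finset.mem_sigma, Finset.mem_powerset] at h
      simp only [Finset.erase_insert (fun hv => Finset.notMem_erase v N (h.2 hv))]
    · rintro ⟨T, v⟩ h
      simp only [Finset.mem_sigma] at h
      simp only [Finset.insert_erase h.2]
    · rintro ⟨v, S⟩ h
      simp only [Finset.mem_sigma, Finset.mem_powerset] at h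
      have hv : v ∉ S := fun hv => Finset.notMem_erase v N (h.2 hv)
      simp only [Finset.card_insert_of_notMem hv, Nat.add_sub_cancel]
  -- Here each `T` arises once for each player outside it.
  have hB : ∑ v ∈ N, ∑ S ∈ (N.erase v).powerset, shapleyWeight N.card S.card * τ S =
      ∑ T ∈ N.powerset, ((N.card - T.card : ℕ) : ℝ) * shapleyWeight N.card T.card * τ T := by
    have : ∀ T ∈ N.powerset, ((N.card - T.card : ℕ) : ℝ) * shapleyWeight N.card T.card * τ T =
        ∑ _v ∈ N \ T, shapleyWeight N.card T.card * τ T := by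
      intro T hT
      rw [Finset.sum_const, nsmul_eq_mul, mul_assoc,
        Finset.card_sdiff_of_subset (Finset.mem_powerset.1 hT)]
    rw [Finset.sum_congr rfl this]
    refine Finset.sum_comm' fun v S => ?_
    simp only [Finset.mem_powerset, Finset.mem_sdiff, Finset.subset_erase]
    tauto
  have hC : ∀ T ∈ N.powerset, (T.card : ℝ) * shapleyWeight N.card (T.card - 1) * τ T -
      ((N.card - T.card : ℕ) : ℝ) * shapleyWeight N.card T.card * τ T =
      (if T = N then τ T else 0) - (if T = ∅ then τ T else 0) := by
    intro T hT
    rcases eq_or_ne T N with rfl | hTN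
    · have e : T.card - (T.card - 1) - 1 = 0 := by omega
      have hw : (T.card : ℝ) * shapleyWeight T.card (T.card - 1) = 1 := by
        rw [shapleyWeight, e, hfac, Nat.factorial_zero, mul_one]
        field_simp
      rw [if_pos rfl, if_neg hN.ne_empty, hw, Nat.sub_self]
      simp
    rcases eq_or_ne T ∅ with rfl | hT0
    · have hw : (N.card : ℝ) * shapleyWeight N.card 0 = 1 := by
        rw [shapleyWeight, hfac, Nat.factorial_zero, one_mul, Nat.sub_zero]
        field_simp
      rw [if_neg hTN, if_pos rfl, Finset.card_empty, Nat.sub_zero, hw]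
      simp
    · rw [if_neg hTN, if_neg hT0, mul_shapleyWeight_pred (Finset.card_ne_zero.2
        (Finset.nonempty_iff_ne_empty.2 hT0)) (Finset.card_lt_card
        ((Finset.mem_powerset.1 hT).ssubset_of_ne hTN))]
      ring
  simp only [shapleyValue_eq, mul_sub, Finset.sum_sub_distrib]
  rw [hA, hB, ← Finset.sum_sub_distrib, Finset.sum_congr rfl hC, Finset.sum_sub_distrib]
  simp

/-- Efficiency for the game "`v ∈ S`", where `v` has constant marginal contribution 1 and all others
are null. -/
theorem sum_shapleyWeight {v : V} (hv : v ∈ N) :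
    ∑ S ∈ (N.erase v).powerset, shapleyWeight N.card S.card = 1 := by
  have h := sum_shapleyValue (N := N) (fun S => if v ∈ S then (1 : ℝ) else 0)
  rw [Finset.sum_eq_single_of_mem v hv] at h
  · rw [shapleyValue_eq] at h
    rw [if_pos hv, if_neg (Finset.notMem_empty v), sub_zero] at h
    rw [← h]
    refine Finset.sum_congr rfl fun S hS => ?_
    rw [if_pos (Finset.mem_insert_self _ _),
      if_neg fun h => Finset.notMem_erase v N (Finset.mem_powerset.1 hS h), sub_zero, mul_one]
  · intro u _ huv
    refine shapleyValue_eq_zero fun S _ => ?_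
    simp [Finset.mem_insert, huv.symm]

/-- A player `v` that does not affect the marginal contributions of `u` can be removed. -/
theorem shapleyValue_erase {τ τ' : Finset V → ℝ} {u v : V} (hu : u ∈ N) (hv : v ∈ N) (huv : u ≠ v)
    (h : ∀ S ⊆ (N.erase v).erase u, τ (insert u S) - τ S = τ' (insert u S) - τ' S)
    (h' : ∀ S ⊆ (N.erase v).erase u,
      τ (insert u (insert v S)) - τ (insert v S) = τ' (insert u S) - τ' S) :
    shapleyValue N τ u = shapleyValue (N.erase v) τ' u := by
  have hN : N.erase u = insert v ((N.erase v).erase u) := by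
    rw [Finset.erase_right_comm, Finset.insert_erase (Finset.mem_erase.2 ⟨huv.symm, hv⟩)]
  have hvn : v ∉ (N.erase v).erase u := by simp
  have hcard : (N.erase v).card + 1 = N.card := Finset.card_erase_add_one hv
  have hcard' : ((N.erase v).erase u).card + 1 = (N.erase v).card :=
    Finset.card_erase_add_one (Finset.mem_erase.2 ⟨huv, hu⟩)
  -- Coalitions with and without `v` are paired; their weights add up by `shapleyWeight_pascal`.
  rw [shapleyValue_eq, shapleyValue_eq, hN, Finset.sum_powerset_insert hvn,
    ← Finset.sum_add_distrib]
  refine Finset.sum_congr rfl fun S hS => ?_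
  have hS := Finset.mem_powerset.1 hS
  have hc := Finset.card_le_card hS
  rw [h S hS, h' S hS, Finset.card_insert_of_notMem fun hvS => hvn (hS hvS), ← hcard,
    ← shapleyWeight_pascal (n := (N.erase v).card) (s := S.card) (by omega)]
  ring

theorem image_swap_image_swap (a b : V) (S : Finset V) :
    (S.image (Equiv.swap a b)).image (Equiv.swap a b) = S := by
  have h : Equiv.swap a b ∘ Equiv.swap a b = id := funext fun x => by simp
  rw [Finset.image_image, h, Finset.image_id]

/-- Symmetric players have the same Shapley value. -/
theorem shapleyValue_swap {τ : Finset V → ℝ} {a b : V} (ha : a ∈ N) (hb : b ∈ N)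
    (h : ∀ S ⊆ N, τ (S.image (Equiv.swap a b)) = τ S) :
    shapleyValue N τ a = shapleyValue N τ b := by
  have hinv := image_swap_image_swap a b
  have hmem : ∀ x ∈ N, Equiv.swap a b x ∈ N := by
    intro x hx
    rw [Equiv.swap_apply_def]
    split_ifs <;> assumption
  rw [shapleyValue_eq, shapleyValue_eq]
  refine Finset.sum_bij' (fun S _ => S.image (Equiv.swap a b))
    (fun S _ => S.image (Equiv.swap a b)) ?_ ?_ (fun S _ => hinv S) (fun S _ => hinv S) ?_
  · intro S hS
    rw [Finset.mem_powerset, Finset.subset_erase] at hS ⊢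
    refine ⟨Finset.image_subset_iff.2 fun x hx => hmem x (hS.1 hx), fun hbS => hS.2 ?_⟩
    obtain ⟨x, hx, hxb⟩ := Finset.mem_image.1 hbS
    rw [Equiv.swap_apply_eq_iff, Equiv.swap_apply_right] at hxb
    exact hxb ▸ hx
  · intro S hS
    rw [Finset.mem_powerset, Finset.subset_erase] at hS ⊢
    refine ⟨Finset.image_subset_iff.2 fun x hx => hmem x (hS.1 hx), fun haS => hS.2 ?_⟩
    obtain ⟨x, hx, hxa⟩ := Finset.mem_image.1 haS
    rw [Equiv.swap_apply_eq_iff, Equiv.swap_apply_left] at hxa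
    exact hxa ▸ hx
  · intro S hS
    rw [Finset.mem_powerset, Finset.subset_erase] at hS
    have e : insert b (S.image (Equiv.swap a b)) = (insert a S).image (Equiv.swap a b) := by
      rw [Finset.image_insert, Equiv.swap_apply_left]
    rw [e, h _ (Finset.insert_subset ha hS.1), h _ hS.1,
      Finset.card_image_of_injective _ (Equiv.injective _)]

/-! ### Activation probabilities -/

namespace Instance

/-- The probability that the seed set `S` activates the node `x`. -/
noncomputable def act (I : Instance V N) (x : V) (S : Finset V) : ℝ :=
  ∑ T ∈ N.powerset, if x ∈ T then I.prob S T else 0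

/-- Linearity of expectation; the restriction `S ⊆ T` is harmless because the other terms vanish. -/
theorem spread_eq_sum_act (I : Instance V N) (w : V → ℝ) (S : Finset V) :
    I.spread w S = ∑ x ∈ N, w x * I.act x S := by
  have h : I.spread w S = ∑ T ∈ N.powerset, I.prob S T * ∑ x ∈ T, w x := by
    rw [spread, Finset.sum_filter]
    refine Finset.sum_congr rfl fun T _ => ?_
    split_ifs with hST
    · rfl
    · rw [I.prob_progressive S T hST, zero_mul]
  simp only [h, act, Finset.mul_sum]
  rw [Finset.sum_comm (s := N)]
  refine Finset.sum_congr rfl fun T hT => ?_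
  rw [← Finset.sum_subset (Finset.mem_powerset.1 hT)]
  · exact Finset.sum_congr rfl fun x hx => by rw [if_pos hx, mul_comm]
  · intro x _ hx
    rw [if_neg hx, mul_zero]

theorem act_of_mem (I : Instance V N) {x : V} {S : Finset V} (hS : S ⊆ N) (hx : x ∈ S) :
    I.act x S = 1 := by
  rw [← I.prob_sum S hS, act]
  refine Finset.sum_congr rfl fun T _ => ?_
  split_ifs with h
  · rfl
  · rw [I.prob_progressive S T fun hST => h (hST hx)]

theorem act_empty (I : Instance V N) (x : V) : I.act x ∅ = 0 := by
  refine Finset.sum_eq_zero fun T _ => ?_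
  split_ifs with h
  · exact I.prob_empty T (Finset.ne_empty_of_mem h)
  · rfl

/-- Pairing `T` with `insert v T` produces the expression used by both the projection and the sink
condition. -/
theorem act_eq_sum_erase (I : Instance V N) {x v : V} (hv : v ∈ N) (hxv : x ≠ v) (S : Finset V) :
    I.act x S = ∑ T ∈ (N.erase v).powerset,
      if x ∈ T then I.prob S T + I.prob S (insert v T) else 0 := by
  have h2 : N.powerset = (insert v (N.erase v)).powerset := by rw [Finset.insert_erase hv]
  rw [act, h2, Finset.sum_powerset_insert (Finset.notMem_erase v N), ← Finset.sum_add_distrib]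
  refine Finset.sum_congr rfl fun T _ => ?_
  simp only [Finset.mem_insert, hxv, false_or]
  split_ifs <;> simp

theorem act_project (I : Instance V N) {x v : V} (hv : v ∈ N) (hxv : x ≠ v) {S : Finset V}
    (hS : S ⊆ N.erase v) : (I.project v hv).act x S = I.act x S := by
  rw [I.act_eq_sum_erase hv hxv, act]
  refine Finset.sum_congr rfl fun T hT => ?_
  simp only [project, if_pos (And.intro hS (Finset.mem_powerset.1 hT))]

theorem IsSink.act_insert {I : Instance V N} {x v : V} (h : I.IsSink v) (hxv : x ≠ v)
    {S : Finset V} (hS : S ⊆ N.erase v) : I.act x (insert v S) = I.act x S := by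
  rw [I.act_eq_sum_erase h.1 hxv, I.act_eq_sum_erase h.1 hxv]
  refine Finset.sum_congr rfl fun T hT => ?_
  have hT := Finset.mem_powerset.1 hT
  rw [h.2 S T hS hT, I.prob_progressive (insert v S) T, zero_add]
  exact fun hs => Finset.notMem_erase v N (hT (hs (Finset.mem_insert_self _ _)))

theorem IsSymmPair.act_image {I : Instance V N} {a b x : V} (h : I.IsSymmPair a b) (ha : a ∈ N)
    (hb : b ∈ N) (hxa : x ≠ a) (hxb : x ≠ b) {S : Finset V} (hS : S ⊆ N) :
    I.act x (S.image (Equiv.swap a b)) = I.act x S := by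
  have hinv := image_swap_image_swap a b
  have hmem : ∀ T ∈ N.powerset, T.image (Equiv.swap a b) ∈ N.powerset := by
    intro T hT
    rw [Finset.mem_powerset] at hT ⊢
    refine Finset.image_subset_iff.2 fun x hx => ?_
    rw [Equiv.swap_apply_def]
    split_ifs
    exacts [hb, ha, hT hx]
  symm
  refine Finset.sum_bij' (fun T _ => T.image (Equiv.swap a b))
    (fun T _ => T.image (Equiv.swap a b)) hmem hmem (fun S _ => hinv S) (fun S _ => hinv S) ?_
  intro T hT
  have hx : x ∈ T.image (Equiv.swap a b) ↔ x ∈ T := by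
    conv_lhs => rw [← Equiv.swap_apply_of_ne_of_ne hxa hxb]
    exact (Equiv.swap a b).injective.mem_finset_image
  simp only [hx, h S T hS (Finset.mem_powerset.1 hT)]

theorem IsSink.shapleyValue_act {I : Instance V N} {x v : V} (h : I.IsSink v) (hxv : x ≠ v) :
    shapleyValue N (I.act x) v = 0 :=
  shapleyValue_eq_zero fun _ hS => h.act_insert hxv hS

theorem shapleyValue_spread (I : Instance V N) (w : V → ℝ) (v : V) :
    shapleyValue N (I.spread w) v = ∑ x ∈ N, w x * shapleyValue N (I.act x) v := by
  rw [← shapleyValue_sum]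
  exact shapleyValue_congr fun S _ => by simp only [spread_eq_sum_act]

theorem IsSink.shapleyValue_spread_self {I : Instance V N} {v : V} (h : I.IsSink v) (w : V → ℝ) :
    shapleyValue N (I.spread w) v = w v * shapleyValue N (I.act v) v := by
  rw [shapleyValue_spread]
  refine Finset.sum_eq_single_of_mem v h.1 fun x _ hx => ?_
  rw [h.shapleyValue_act hx, mul_zero]

/-- Targets other than `v` contribute equally before and after projection, so only the target `v` is
lost. For a sink `u` the last term vanishes, which is the sink axiom. -/
theorem IsSink.shapleyValue_spread_project {I : Instance V N} {u v : V} (h : I.IsSink v)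
    (hu : u ∈ N) (huv : u ≠ v) (w : V → ℝ) :
    shapleyValue N (I.spread w) u =
      shapleyValue (N.erase v) ((I.project v h.1).spread w) u +
        w v * shapleyValue N (I.act v) u := by
  rw [shapleyValue_spread, shapleyValue_spread, ← Finset.sum_erase_add _ _ h.1]
  congr 1
  refine Finset.sum_congr rfl fun x hx => ?_
  have hxv := Finset.ne_of_mem_erase hx
  congr 1
  have hu' : u ∈ N.erase v := Finset.mem_erase.2 ⟨huv, hu⟩
  refine shapleyValue_erase hu h.1 huv ?_ ?_
  · intro S hS
    have hS' := hS.trans (Finset.erase_subset _ _)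
    rw [I.act_project h.1 hxv hS', I.act_project h.1 hxv (Finset.insert_subset hu' hS')]
  · intro S hS
    have hS' := hS.trans (Finset.erase_subset _ _)
    rw [I.act_project h.1 hxv hS', I.act_project h.1 hxv (Finset.insert_subset hu' hS'),
      Finset.insert_comm, h.act_insert hxv hS', h.act_insert hxv (Finset.insert_subset hu' hS')]

end Instance

/-! ### The weighted Shapley centrality satisfies the axioms -/

theorem Instance.IsCriticalSet.spread_eq {I : Instance V N} {R U S : Finset V}
    (h : I.IsCriticalSet R U) (w : V → ℝ) (hS : S ⊆ N) :
    I.spread w S = if R ⊆ S then ∑ x ∈ U ∪ S, w x else ∑ x ∈ S, w x := by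
  have key : ∀ T ⊆ N, I.prob S T = 1 → I.spread w S = ∑ x ∈ T, w x := by
    intro T hT h1
    have hST : S ⊆ T := by
      by_contra hST
      rw [I.prob_progressive S T hST] at h1
      exact zero_ne_one h1
    have hT' := Finset.mem_powerset.2 hT
    have h0 : ∀ T' ∈ N.powerset, T' ≠ T → I.prob S T' = 0 := by
      intro T' hT'' hne
      have hs := I.prob_sum S hS
      rw [← Finset.sum_erase_add _ _ hT', h1, add_eq_right,
        Finset.sum_eq_zero_iff_of_nonneg fun _ _ => I.prob_nonneg _ _] at hs
      exact hs T' (Finset.mem_erase.2 ⟨hne, hT''⟩)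
    rw [Instance.spread, Finset.sum_eq_single_of_mem T (Finset.mem_filter.2 ⟨hT', hST⟩), h1,
      one_mul]
    intro T' hT'' hne
    rw [h0 T' (Finset.mem_filter.1 hT'').1 hne, zero_mul]
  split_ifs with hR
  · exact key _ (Finset.union_subset h.subset_nodes hS) (h.active S hS hR)
  · exact key _ hS (h.inactive S hS hR)

/-- The node `v` contributes `w v` unless its predecessors are all of `R`, which has probability `1
/ (|R| + 1)`; then `R` has already activated it. -/
theorem Instance.IsCriticalSet.shapleyValue_spread {R : Finset V} {v : V} (hv : v ∉ R)
    {I : Instance V (insert v R)} (h : I.IsCriticalSet R (insert v R)) (w : V → ℝ) :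
    shapleyValue (insert v R) (I.spread w) v = (R.card : ℝ) * w v / ((R.card : ℝ) + 1) := by
  have hN : (insert v R).erase v = R := Finset.erase_insert hv
  have hw : shapleyWeight (insert v R).card R.card = 1 / ((R.card : ℝ) + 1) := by
    have hf : (R.card.factorial : ℝ) ≠ 0 := by positivity
    have e : R.card + 1 - R.card - 1 = 0 := by omega
    rw [shapleyWeight, Finset.card_insert_of_notMem hv, e, Nat.factorial_succ,
      Nat.factorial_zero, mul_one]
    push_cast
    field_simp
  have h1 := sum_shapleyWeight (Finset.mem_insert_self v R)
  rw [hN] at h1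
  have hm : ∀ S ∈ R.powerset, shapleyWeight (insert v R).card S.card *
      (I.spread w (insert v S) - I.spread w S) = shapleyWeight (insert v R).card S.card * w v -
        if S = R then shapleyWeight (insert v R).card S.card * w v else 0 := by
    intro S hS
    have hS := Finset.mem_powerset.1 hS
    have hvS : v ∉ S := fun hh => hv (hS hh)
    rw [h.spread_eq w (Finset.insert_subset_insert v hS),
      h.spread_eq w (hS.trans (Finset.subset_insert v R))]
    simp only [Finset.subset_insert_iff_of_notMem hv]
    by_cases hRS : R ⊆ S
    · obtain rfl := hS.antisymm hRS
      simp
    · have hne : S ≠ R := fun e => hRS e.ge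
      rw [if_neg hRS, if_neg hRS, if_neg hne, Finset.sum_insert hvS]
      ring
  rw [shapleyValue_eq, hN, Finset.sum_congr rfl hm, Finset.sum_sub_distrib, ← Finset.sum_mul, h1,
    Finset.sum_ite_eq' _ R, if_pos (Finset.mem_powerset_self R), hw]
  field_simp
  ring

-- In the game `act v`, of total worth 1, sinks other than `v` are null and non-sinks are
-- interchangeable, so the latter split equally what `v` leaves.
open Classical in
theorem Instance.IsSink.shapleyValue_act_eq {I : Instance V N}
    (hI : ∀ a ∈ N, ∀ b ∈ N, ¬ I.IsSink a → ¬ I.IsSink b → I.IsSymmPair a b) {u v : V}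
    (hv : I.IsSink v) (hu : u ∈ N) (hus : ¬ I.IsSink u) :
    shapleyValue N (I.act v) u =
      1 / ((N.filter fun x => ¬ I.IsSink x).card : ℝ) * (1 - shapleyValue N (I.act v) v) := by
  have heff := sum_shapleyValue (N := N) (I.act v)
  rw [I.act_empty, I.act_of_mem subset_rfl hv.1, sub_zero,
    ← Finset.sum_filter_add_sum_filter_not N (fun x => I.IsSink x)] at heff
  have h1 : ∑ x ∈ N with I.IsSink x, shapleyValue N (I.act v) x = shapleyValue N (I.act v) v :=
    Finset.sum_eq_single_of_mem v (Finset.mem_filter.2 ⟨hv.1, hv⟩) fun x hx hxv =>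
      (Finset.mem_filter.1 hx).2.shapleyValue_act hxv.symm
  have h2 : ∑ x ∈ N with ¬ I.IsSink x, shapleyValue N (I.act v) x =
      ((N.filter fun x => ¬ I.IsSink x).card : ℝ) * shapleyValue N (I.act v) u := by
    rw [← nsmul_eq_mul, ← Finset.sum_const]
    refine Finset.sum_congr rfl fun x hx => ?_
    obtain ⟨hx, hxs⟩ := Finset.mem_filter.1 hx
    refine shapleyValue_swap hx hu fun S hS => ?_
    refine (hI x hx u hu hxs hus).act_image hx hu ?_ ?_ hS
    · rintro rfl; exact hxs hv
    · rintro rfl; exact hus hv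
  have hc : ((N.filter fun x => ¬ I.IsSink x).card : ℝ) ≠ 0 :=
    Nat.cast_ne_zero.2 (Finset.card_ne_zero.2 ⟨u, Finset.mem_filter.2 ⟨hu, hus⟩⟩)
  rw [h1, h2] at heff
  field_simp
  linarith

theorem satisfiesAxioms_weightedShapley (w : V → ℝ) : SatisfiesAxioms w (weightedShapley w) where
  normalization N I := by
    have h0 : I.spread w ∅ = 0 := by simp [Instance.spread_eq_sum_act, Instance.act_empty]
    have h1 : I.spread w N = ∑ v ∈ N, w v := by
      rw [Instance.spread_eq_sum_act]
      exact Finset.sum_congr rfl fun x hx => by rw [I.act_of_mem subset_rfl hx, mul_one]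
    rw [← h1, ← sub_zero (I.spread w N), ← h0, ← sum_shapleyValue]
    exact Finset.sum_coe_sort N (shapleyValue N (I.spread w))
  sink N I u v hu hv huv hus hvs := by
    have h := hvs.shapleyValue_spread_project hu huv w
    rwa [hus.shapleyValue_act huv.symm, mul_zero, add_zero] at h
  bayesian N r E I hE p hp hp1 v := by
    change shapleyValue N _ v = ∑ i, p i * shapleyValue N ((I i).spread w) v
    rw [← shapleyValue_sum]
    congr 1
    funext S
    have h : ∀ W : Finset V → ℝ, ∑ T ∈ N.powerset with S ⊆ T, (∑ i, p i * (I i).prob S T) * W T =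
        ∑ i, p i * ∑ T ∈ N.powerset with S ⊆ T, (I i).prob S T * W T := by
      intro W
      simp only [Finset.sum_mul, Finset.mul_sum, mul_assoc]
      exact Finset.sum_comm
    exact h _
  critical R v hv I hI := hI.shapleyValue_spread hv w
  symmetry N I hI u v hu hv huv hus hvs := by
    change shapleyValue N (I.spread w) u = shapleyValue (N.erase v) ((I.project v hv).spread w) u +
      _ * (w v - shapleyValue N (I.spread w) v)
    rw [hvs.shapleyValue_spread_project hu huv w, hvs.shapleyValue_spread_self,
      hvs.shapleyValue_act_eq hI hu hus]
    ring

/-! ### Instances with a deterministic influence profile -/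

namespace Instance

/-- The same influence profile on the complete directed graph. -/
def complete (I : Instance V N) : Instance V N :=
  { I with
    edges := {e | e.1 ∈ N ∧ e.2 ∈ N}
    edges_mem := fun _ _ h => h }

/-- In the instance `I` every seed set `S` activates exactly `f S`. -/
def Follows (I : Instance V N) (f : Finset V → Finset V) : Prop :=
  ∀ S ⊆ N, ∀ T, I.prob S T = if T = f S then 1 else 0

/-- The instance on the complete directed graph in which `S` activates exactly `f S`. -/
def deterministic (N : Finset V) (f : Finset V → Finset V) (hf : ∀ S ⊆ N, S ⊆ f S ∧ f S ⊆ N)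
    (h0 : f ∅ = ∅) : Instance V N where
  edges := {e | e.1 ∈ N ∧ e.2 ∈ N}
  edges_mem _ _ h := h
  prob S T := if S ⊆ N ∧ T = f S then 1 else 0
  prob_off S T h := if_neg fun hh : S ⊆ N ∧ T = f S => h ⟨hh.1, hh.2 ▸ (hf S hh.1).2⟩
  prob_nonneg S T := by split_ifs <;> norm_num
  prob_sum S hS := by
    simp only [hS, true_and]
    rw [Finset.sum_ite_eq', if_pos (Finset.mem_powerset.2 (hf S hS).2)]
  prob_empty_empty := if_pos ⟨Finset.empty_subset _, h0.symm⟩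
  prob_empty T hT := if_neg fun h : ∅ ⊆ N ∧ T = f ∅ => hT (h.2.trans h0)
  prob_progressive S T h := if_neg fun hh : S ⊆ N ∧ T = f S => h (hh.2 ▸ (hf S hh.1).1)

theorem deterministic_follows {f : Finset V → Finset V} (hf : ∀ S ⊆ N, S ⊆ f S ∧ f S ⊆ N)
    (h0 : f ∅ = ∅) : (deterministic N f hf h0).Follows f := fun S hS T => by
  simp only [deterministic, hS, true_and]

namespace Follows

variable {I : Instance V N} {f g : Finset V → Finset V}

theorem congr (h : I.Follows f) (hfg : ∀ S ⊆ N, f S = g S) : I.Follows g := fun S hS T => by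
  rw [h S hS T, hfg S hS]

theorem subset_nodes (h : I.Follows f) {S : Finset V} (hS : S ⊆ N) : f S ⊆ N := by
  by_contra hf
  have h1 := h S hS (f S)
  rw [if_pos rfl, I.prob_off _ _ fun hh => hf hh.2] at h1
  exact zero_ne_one h1

theorem prob_add_prob (h : I.Follows f) {v : V} {S T : Finset V} (hS : S ⊆ N) (hT : v ∉ T) :
    I.prob S T + I.prob S (insert v T) = if T = (f S).erase v then 1 else 0 := by
  rw [h S hS, h S hS]
  by_cases hv : v ∈ f S
  · have h1 : T ≠ f S := fun e => hT (e ▸ hv)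
    have h2 : insert v T = f S ↔ T = (f S).erase v :=
      ⟨fun e => by rw [← e, Finset.erase_insert hT], fun e => by rw [e, Finset.insert_erase hv]⟩
    rw [if_neg h1, zero_add]
    simp only [h2]
  · have h1 : insert v T ≠ f S := fun e => hv (e ▸ Finset.mem_insert_self _ _)
    rw [if_neg h1, add_zero, Finset.erase_eq_of_notMem hv]

theorem isSink (h : I.Follows f) {v : V} (hv : v ∈ N)
    (hf : ∀ S ⊆ N.erase v, f (insert v S) = insert v (f S)) : I.IsSink v := by
  refine ⟨hv, fun S T hS hT => ?_⟩
  have hvT : v ∉ T := fun hh => Finset.notMem_erase v N (hT hh)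
  have hS' := hS.trans (Finset.erase_subset _ _)
  have e : insert v T = insert v (f S) ↔ T = (f S).erase v := by
    refine ⟨fun e => ?_, fun e => ?_⟩
    · rw [← Finset.erase_insert_eq_erase, ← e, Finset.erase_insert hvT]
    · rw [e]
      ext x
      by_cases hx : x = v <;> simp [hx]
  rw [h.prob_add_prob hS' hvT, h _ (Finset.insert_subset hv hS'), hf S hS]
  simp only [e]

theorem project (h : I.Follows f) {v : V} (hv : v ∈ N) :
    (I.project v hv).Follows fun S => (f S).erase v := by
  intro S hS T
  have hS' := hS.trans (Finset.erase_subset _ _)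
  by_cases hT : T ⊆ N.erase v
  · have hvT : v ∉ T := fun hh => Finset.notMem_erase v N (hT hh)
    rw [← h.prob_add_prob hS' hvT]
    exact if_pos ⟨hS, hT⟩
  · rw [(I.project v hv).prob_off S T fun hh => hT hh.2, if_neg]
    rintro rfl
    exact hT (Finset.erase_subset_erase _ (h.subset_nodes hS'))

end Follows

/-- The activation of a critical set instance with critical set `R` and target set `U`. -/
def criticalMap (R U S : Finset V) : Finset V := if R ⊆ S then U ∪ S else S

theorem criticalMap_self (R S : Finset V) : criticalMap R R S = S := by
  rw [criticalMap]
  split_ifs with h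
  · exact Finset.union_eq_right.2 h
  · rfl

theorem Follows.isSink_of_notMem {I : Instance V N} {R U : Finset V}
    (h : I.Follows (criticalMap R U)) {v : V} (hv : v ∈ N) (hvR : v ∉ R) : I.IsSink v := by
  refine h.isSink hv fun S _ => ?_
  simp only [criticalMap, Finset.subset_insert_iff_of_notMem hvR]
  split_ifs
  · rw [Finset.union_insert]
  · rfl

theorem Follows.project_criticalMap {I : Instance V N} {R U : Finset V}
    (h : I.Follows (criticalMap R U)) {v : V} (hv : v ∈ N) :
    (I.project v hv).Follows (criticalMap R (U.erase v)) := by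
  refine (h.project hv).congr fun S hS => ?_
  have hvS : v ∉ S := fun hh => Finset.notMem_erase v N (hS hh)
  simp only [criticalMap]
  split_ifs
  · rw [Finset.erase_union_distrib, Finset.erase_eq_of_notMem hvS]
  · rw [Finset.erase_eq_of_notMem hvS]

theorem Follows.not_isSink {I : Instance V N} {R U : Finset V} (h : I.Follows (criticalMap R U))
    (hRU : R ⊂ U) (hU : U ⊆ N) {u : V} (hu : u ∈ R) : ¬ I.IsSink u := by
  intro hs
  have hR := hRU.subset.trans hU
  -- With these sets the sink condition reads `1 = 0 + 0`: `R` activates `U`, but `R.erase u` only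
  -- itself, which is neither `U.erase u` nor `U`.
  have h1 := hs.2 (R.erase u) (U.erase u) (Finset.erase_subset_erase _ hR)
    (Finset.erase_subset_erase _ hU)
  have hn : ¬ R ⊆ R.erase u := fun hh => Finset.notMem_erase u R (hh hu)
  have e1 : U.erase u ≠ R.erase u := by
    intro e
    apply hRU.ne
    rw [← Finset.insert_erase hu, ← e, Finset.insert_erase (hRU.subset hu)]
  have e2 : U ≠ R.erase u := fun e => Finset.notMem_erase u R (e ▸ hRU.subset hu)
  rw [Finset.insert_erase hu, Finset.insert_erase (hRU.subset hu), h R hR,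
    h _ ((Finset.erase_subset _ _).trans hR), h _ ((Finset.erase_subset _ _).trans hR)] at h1
  simp only [criticalMap, if_neg hn, if_pos subset_rfl, Finset.union_eq_left.2 hRU.subset,
    if_neg e1, if_neg e2] at h1
  norm_num at h1

/-- The swap fixes `R` and `U` as sets, hence commutes with `criticalMap R U`. -/
theorem Follows.isSymmPair {I : Instance V N} {R U : Finset V} (h : I.Follows (criticalMap R U))
    (hRU : R ⊆ U) (hU : U ⊆ N) {a b : V} (ha : a ∈ R) (hb : b ∈ R) : I.IsSymmPair a b := by
  have key : ∀ X : Finset V, a ∈ X → b ∈ X → X.image (Equiv.swap a b) = X := by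
    intro X haX hbX
    refine Finset.eq_of_subset_of_card_le (Finset.image_subset_iff.2 fun x hx => ?_)
      (Finset.card_image_of_injective _ (Equiv.injective _)).ge
    rw [Equiv.swap_apply_def]
    split_ifs <;> assumption
  have hinj : Function.Injective fun X : Finset V => X.image (Equiv.swap a b) :=
    Function.LeftInverse.injective (image_swap_image_swap a b)
  intro S T hS _
  have hS' : S.image (Equiv.swap a b) ⊆ N := by
    rw [← key N (hU (hRU ha)) (hU (hRU hb))]
    exact Finset.image_subset_image hS
  have e : criticalMap R U (S.image (Equiv.swap a b)) =
      (criticalMap R U S).image (Equiv.swap a b) := by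
    have hR : R ⊆ S.image (Equiv.swap a b) ↔ R ⊆ S := by
      conv_lhs => rw [← key R ha hb]
      exact Finset.image_subset_image_iff (Equiv.injective _)
    simp only [criticalMap, hR]
    split_ifs
    · rw [Finset.image_union, key U (hRU ha) (hRU hb)]
    · rfl
  rw [h S hS, h _ hS', e]
  simp only [hinj.eq_iff (a := T)]

theorem Follows.isCriticalSet {R : Finset V} {v : V} {I : Instance V (insert v R)}
    (h : I.Follows (criticalMap R (insert v R))) (hR : R.Nonempty) :
    I.complete.IsCriticalSet R (insert v R) where
  nonempty := hR
  subset := Finset.subset_insert _ _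
  subset_nodes := subset_rfl
  bipartite a ha b hb := ⟨Finset.mem_insert_of_mem ha, (Finset.mem_sdiff.1 hb).1⟩
  isolated _ he := he
  active S hS hRS := by
    change I.prob S _ = 1
    rw [h S hS, criticalMap, if_pos hRS, if_pos rfl]
  inactive S hS hRS := by
    change I.prob S _ = 1
    rw [h S hS, criticalMap, if_neg hRS, if_pos rfl]

end Instance

/-! ### Measures that satisfy the axioms agree on critical set instances -/

section Uniqueness

variable {w : V → ℝ} {ψ φ : CentralityMeasure V}

/-- All nodes are sinks, so all but `u` can be projected away; normalization decides the one-node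
instance. -/
theorem SatisfiesAxioms.value_eq_of_follows_id (hψ : SatisfiesAxioms w ψ)
    (hφ : SatisfiesAxioms w φ) {N : Finset V} {I : Instance V N} (h : I.Follows id) (u : N) :
    ψ.value I u = φ.value I u := by
  induction hn : N.card generalizing N with
  | zero => exact absurd hn (Finset.card_ne_zero.2 ⟨u, u.2⟩)
  | succ n ih =>
    obtain ⟨u, hu⟩ := u
    have hs : ∀ v ∈ N, I.IsSink v := fun v hv => h.isSink hv fun S _ => rfl
    by_cases hv : ∃ v ∈ N, u ≠ v
    · obtain ⟨v, hv, huv⟩ := hv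
      rw [hψ.sink N I u v hu hv huv (hs u hu) (hs v hv),
        hφ.sink N I u v hu hv huv (hs u hu) (hs v hv)]
      refine ih ((h.project hv).congr fun S hS => ?_) _ ?_
      · exact Finset.erase_eq_of_notMem fun hh => Finset.notMem_erase v N (hS hh)
      · rw [Finset.card_erase_of_mem hv, hn, Nat.add_sub_cancel]
    · push Not at hv
      have : Subsingleton N := ⟨fun x y => Subtype.ext ((hv x x.2).symm.trans (hv y y.2))⟩
      have h1 := hψ.normalization N I
      rw [← hφ.normalization N I] at h1
      rwa [Fintype.sum_subsingleton _ ⟨u, hu⟩, Fintype.sum_subsingleton _ ⟨u, hu⟩] at h1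

theorem SatisfiesAxioms.value_eq_of_follows_criticalMap (hψ : SatisfiesAxioms w ψ)
    (hφ : SatisfiesAxioms w φ) {N R U : Finset V} {I : Instance V N}
    (h : I.Follows (Instance.criticalMap R U)) (hR : R.Nonempty) (hRU : R ⊆ U) (hU : U ⊆ N)
    (u : N) : ψ.value I u = φ.value I u := by
  induction hn : N.card generalizing N U with
  | zero => exact absurd hn (Finset.card_ne_zero.2 ⟨u, u.2⟩)
  | succ n ih =>
    rcases eq_or_ne R U with rfl | hne
    · exact hψ.value_eq_of_follows_id hφ (h.congr fun S _ => Instance.criticalMap_self R S) u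
    have hss : R ⊂ U := hRU.ssubset_of_ne hne
    have hproj : ∀ v (hv : v ∈ N), v ∉ R → ∀ x,
        ψ.value (I.project v hv) x = φ.value (I.project v hv) x := by
      intro v hv hvR x
      refine ih (h.project_criticalMap hv) ?_ (Finset.erase_subset_erase _ hU) x ?_
      · exact Finset.subset_erase.2 ⟨hRU, hvR⟩
      · rw [Finset.card_erase_of_mem hv, hn, Nat.add_sub_cancel]
    obtain ⟨u, hu⟩ := u
    have hsink : ∀ u (hu : u ∈ N), u ∉ R → ψ.value I ⟨u, hu⟩ = φ.value I ⟨u, hu⟩ := by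
      clear hu u
      intro u hu huR
      by_cases hv : ∃ v ∈ N, v ∉ R ∧ u ≠ v
      · obtain ⟨v, hv, hvR, huv⟩ := hv
        have hus := h.isSink_of_notMem hu huR
        have hvs := h.isSink_of_notMem hv hvR
        rw [hψ.sink N I u v hu hv huv hus hvs, hφ.sink N I u v hu hv huv hus hvs]
        exact hproj v hv hvR _
      -- Now `u` is the only node outside `R`, so `U = N = insert u R` and bargaining applies once
      -- the graph is completed.
      · push Not at hv
        obtain ⟨x, hxU, hxR⟩ := Finset.exists_of_ssubset hss
        obtain rfl := hv x (hU hxU) hxR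
        have hNR : N ⊆ insert u R := fun y hy => by
          by_cases hyR : y ∈ R
          · exact Finset.mem_insert_of_mem hyR
          · rw [hv y hy hyR]
            exact Finset.mem_insert_self _ _
        obtain rfl : N = insert u R := hNR.antisymm (Finset.insert_subset hu (hRU.trans hU))
        obtain rfl : U = insert u R := hU.antisymm (Finset.insert_subset hxU hRU)
        have hc := h.isCriticalSet hR
        rw [ψ.value_eq I I.complete rfl, φ.value_eq I I.complete rfl,
          hψ.critical R u huR _ hc, hφ.critical R u huR _ hc]
    by_cases huR : u ∈ R
    -- The non-sinks are exactly the nodes of `R`. Symmetry with a sink `v` reduces the value at `u`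
    -- to a projected instance and to the value at `v`, both already settled.
    · obtain ⟨v, hvU, hvR⟩ := Finset.exists_of_ssubset hss
      have hv := hU hvU
      have huv : u ≠ v := fun e => hvR (e ▸ huR)
      have hsym : ∀ a ∈ N, ∀ b ∈ N, ¬ I.IsSink a → ¬ I.IsSink b → I.IsSymmPair a b := by
        intro a ha b hb has hbs
        refine h.isSymmPair hRU hU ?_ ?_
        · by_contra haR
          exact has (h.isSink_of_notMem ha haR)
        · by_contra hbR
          exact hbs (h.isSink_of_notMem hb hbR)
      have hus := h.not_isSink hss hU huR
      have hvs := h.isSink_of_notMem hv hvR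
      rw [hψ.symmetry N I hsym u v hu hv huv hus hvs, hφ.symmetry N I hsym u v hu hv huv hus hvs,
        hproj v hv hvR, hsink v hv hvR]
    · exact hsink u hu huR

/-! ### Decomposition of influence profiles -/

/-- The mixture of a finite family of instances, on the complete directed graph. -/
noncomputable def Instance.mix {ι : Type*} [Fintype ι] (I : ι → Instance V N) (p : ι → ℝ)
    (hp : ∀ i, 0 ≤ p i) (hp1 : ∑ i, p i = 1) : Instance V N :=
  Instance.bayesian {e | e.1 ∈ N ∧ e.2 ∈ N}
    (fun j : Fin (Fintype.card ι) => (I ((Fintype.equivFin ι).symm j)).complete) (fun _ => rfl)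
    (fun j => p ((Fintype.equivFin ι).symm j)) (fun _ => hp _)
    (((Fintype.equivFin ι).symm.sum_comp p).trans hp1)

theorem Instance.mix_prob {ι : Type*} [Fintype ι] (I : ι → Instance V N) (p : ι → ℝ)
    (hp : ∀ i, 0 ≤ p i) (hp1 : ∑ i, p i = 1) (S T : Finset V) :
    (Instance.mix I p hp hp1).prob S T = ∑ i, p i * (I i).prob S T :=
  (Fintype.equivFin ι).symm.sum_comp fun i => p i * (I i).prob S T

theorem SatisfiesAxioms.value_mix (hψ : SatisfiesAxioms w ψ) {ι : Type*} [Fintype ι]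
    (I : ι → Instance V N) (p : ι → ℝ) (hp : ∀ i, 0 ≤ p i) (hp1 : ∑ i, p i = 1) (v : N) :
    ψ.value (Instance.mix I p hp hp1) v = ∑ i, p i * ψ.value (I i) v := by
  refine (hψ.bayesian N _ _ _ _ _ _ _ v).trans ?_
  rw [← (Fintype.equivFin ι).symm.sum_comp]
  exact Finset.sum_congr rfl fun j _ => by
    rw [ψ.value_eq (I ((Fintype.equivFin ι).symm j)).complete (I ((Fintype.equivFin ι).symm j)) rfl]

/-- Both sides of `h` have nonnegative coefficients of total `1 + ∑ i, c i`. Dividing by this total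
yields two mixtures with the same profile, to which the Bayesian axiom applies. -/
theorem SatisfiesAxioms.value_conic (hψ : SatisfiesAxioms w ψ) {ι : Type*} [Fintype ι]
    (K Z : Instance V N) (I : ι → Instance V N) (c : ι → ℝ) (hc : ∀ i, 0 ≤ c i)
    (h : ∀ S T, K.prob S T + (∑ i, c i) * Z.prob S T = ∑ i, c i * (I i).prob S T + Z.prob S T)
    (v : N) :
    ψ.value K v + (∑ i, c i) * ψ.value Z v = ∑ i, c i * ψ.value (I i) v + ψ.value Z v := by
  have hC : 0 ≤ ∑ i, c i := Finset.sum_nonneg fun i _ => hc i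
  set C := ∑ i, c i with hCdef
  have ha : 0 < (1 + C)⁻¹ := by positivity
  set a := (1 + C)⁻¹ with hadef
  have ha1 : a * (1 + C) = 1 := inv_mul_cancel₀ (by positivity)
  have hp : ∀ b : Bool, 0 ≤ cond b a (a * C) := by
    rintro (_ | _)
    exacts [mul_nonneg ha.le hC, ha.le]
  have hp1 : ∑ b : Bool, cond b a (a * C) = 1 := by
    rw [Fintype.sum_bool, ← ha1]
    simp only [cond_true, cond_false]
    ring
  have hq : ∀ i : Option ι, 0 ≤ i.elim a fun i => a * c i := by
    rintro (_ | i)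
    exacts [ha.le, mul_nonneg ha.le (hc i)]
  have hq1 : ∑ i : Option ι, (i.elim a fun i => a * c i) = 1 := by
    rw [Fintype.sum_option, ← ha1]
    simp only [Option.elim_none, Option.elim_some]
    rw [← Finset.mul_sum, ← hCdef]
    ring
  have h1 := hψ.value_mix (fun b : Bool => cond b K Z) _ hp hp1 v
  have h2 := hψ.value_mix (fun i : Option ι => i.elim Z I) _ hq hq1 v
  have he : Instance.prob (Instance.mix (fun b : Bool => cond b K Z) _ hp hp1) =
      Instance.prob (Instance.mix (fun i : Option ι => i.elim Z I) _ hq hq1) := by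
    funext S T
    rw [Instance.mix_prob, Instance.mix_prob, Fintype.sum_bool, Fintype.sum_option]
    simp only [cond_true, cond_false, Option.elim_none, Option.elim_some, mul_assoc]
    rw [← Finset.mul_sum, ← mul_add, ← mul_add, h S T, add_comm]
  rw [ψ.value_eq _ _ he, h2, Fintype.sum_bool, Fintype.sum_option] at h1
  simp only [cond_true, cond_false, Option.elim_none, Option.elim_some, mul_assoc] at h1
  rw [← Finset.mul_sum, ← mul_add, ← mul_add] at h1
  rw [← mul_left_cancel₀ ha.ne' h1, add_comm]

namespace Instance

/-- The instance in which every seed set activates only itself. -/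
def null (N : Finset V) : Instance V N :=
  deterministic N id (fun _ hS => ⟨subset_rfl, hS⟩) rfl

/-- The activation in which `S` activates `T`, and every other set only itself. -/
def elementaryMap (N S T X : Finset V) : Finset V :=
  if X = S ∧ S.Nonempty ∧ S ⊆ T ∧ T ⊆ N then T else X

/-- The instance in which `S` activates `T`, and every other seed set only itself. -/
def elementary (N S T : Finset V) : Instance V N :=
  deterministic N (elementaryMap N S T)
    (fun X hX => by
      rw [elementaryMap]
      split_ifs with h
      · exact ⟨h.1 ▸ h.2.2.1, h.2.2.2⟩
      · exact ⟨subset_rfl, hX⟩)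
    (if_neg fun h => h.2.1.ne_empty h.1.symm)

theorem prob_mul_elementary (I : Instance V N) (S T X Y : Finset V) :
    I.prob S T * (elementary N S T).prob X Y = I.prob S T * (null N).prob X Y +
      if X = S then I.prob X T * ((if X ⊆ N ∧ Y = T then 1 else 0) - (null N).prob X Y) else 0 := by
  simp only [elementary, null, deterministic, id_eq, elementaryMap]
  by_cases hX : X = S
  · subst hX
    by_cases h : X.Nonempty ∧ X ⊆ T ∧ T ⊆ N
    · simp only [h, true_and, if_true]
      ring
    -- For a degenerate pair the elementary instance is null. Either its coefficient vanishes or `X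
    -- = T = ∅`, where the correction is zero.
    · simp only [h, and_false, if_false, if_true]
      by_cases hXT : X ⊆ T ∧ X ⊆ N ∧ T ⊆ N
      · have hX0 : X = ∅ := by
          by_contra h0
          exact h ⟨Finset.nonempty_iff_ne_empty.2 h0, hXT.1, hXT.2.2⟩
        subst hX0
        rcases eq_or_ne T ∅ with rfl | hT
        · ring
        · rw [I.prob_empty T hT]
          ring
      · have h0 : I.prob X T = 0 := by
          by_cases hXT' : X ⊆ T
          · exact I.prob_off X T fun hh => hXT ⟨hXT', hh⟩
          · exact I.prob_progressive X T hXT'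
        rw [h0]
        ring
  · simp only [hX, false_and, if_false, add_zero]

theorem prob_decomposition [Fintype V] (I : Instance V N) (X Y : Finset V) :
    I.prob X Y + (∑ q : Finset V × Finset V, I.prob q.1 q.2) * (null N).prob X Y =
      ∑ q : Finset V × Finset V, I.prob q.1 q.2 * (elementary N q.1 q.2).prob X Y +
        (null N).prob X Y := by
  simp only [prob_mul_elementary, Finset.sum_add_distrib, ← Finset.sum_mul]
  have h : ∑ q : Finset V × Finset V, (if X = q.1 then I.prob X q.2 *
      ((if X ⊆ N ∧ Y = q.2 then 1 else 0) - (null N).prob X Y) else 0) =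
      I.prob X Y - (null N).prob X Y := by
    -- Only pairs with first component `X` contribute, and row `X` of the profile sums to 1.
    rw [Fintype.sum_prod_type_right]
    simp only [Finset.sum_ite_eq, Finset.mem_univ, if_true]
    by_cases hX : X ⊆ N
    · have hs : ∑ T, I.prob X T = 1 := by
        rw [← I.prob_sum X hX]
        refine (Finset.sum_subset (Finset.subset_univ _) fun T _ hT => ?_).symm
        exact I.prob_off X T fun hh => hT (Finset.mem_powerset.2 hh.2)
      simp only [mul_sub, Finset.sum_sub_distrib, ← Finset.sum_mul, hs, hX, true_and, mul_ite,
        mul_one, mul_zero, Finset.sum_ite_eq, Finset.mem_univ, if_true, one_mul]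
    · simp only [hX, false_and, if_false, null, deterministic, sub_self, mul_zero,
        Finset.sum_const_zero, I.prob_off X Y fun hh => hX hh.1]
  rw [h]
  ring

end Instance

theorem SatisfiesAxioms.value_decomposition [Fintype V] (hψ : SatisfiesAxioms w ψ)
    (I : Instance V N) (v : N) :
    ψ.value I v + (∑ q : Finset V × Finset V, I.prob q.1 q.2) * ψ.value (Instance.null N) v =
      ∑ q : Finset V × Finset V, I.prob q.1 q.2 * ψ.value (Instance.elementary N q.1 q.2) v +
        ψ.value (Instance.null N) v :=
  hψ.value_conic I (Instance.null N) (fun q : Finset V × Finset V => Instance.elementary N q.1 q.2)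
    (fun q => I.prob q.1 q.2) (fun _ => I.prob_nonneg _ _) I.prob_decomposition v

/-- Both measures agree on the null instance, so its terms cancel when the two decompositions are
subtracted. -/
theorem SatisfiesAxioms.value_sub_value [Fintype V] (hψ : SatisfiesAxioms w ψ)
    (hφ : SatisfiesAxioms w φ) (I : Instance V N) (v : N) :
    ψ.value I v - φ.value I v = ∑ q : Finset V × Finset V, I.prob q.1 q.2 *
      (ψ.value (Instance.elementary N q.1 q.2) v - φ.value (Instance.elementary N q.1 q.2) v) := by
  have h0 : ψ.value (Instance.null N) v = φ.value (Instance.null N) v :=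
    hψ.value_eq_of_follows_id hφ (Instance.deterministic_follows _ _) v
  have h1 := hψ.value_decomposition I v
  have h2 := hφ.value_decomposition I v
  simp only [mul_sub, Finset.sum_sub_distrib]
  rw [h0] at h1
  linarith

theorem SatisfiesAxioms.value_elementary [Fintype V] (hψ : SatisfiesAxioms w ψ)
    (hφ : SatisfiesAxioms w φ) (S T : Finset V) (v : N) :
    ψ.value (Instance.elementary N S T) v = φ.value (Instance.elementary N S T) v := by
  induction hn : N.card - S.card using Nat.strong_induction_on generalizing S T with
  | _ n ih =>
    -- Degenerate pairs give the identity activation.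
    have hdeg : ∀ S T : Finset V, (S.Nonempty → S ⊆ T → T ⊆ N → S = T) →
        ψ.value (Instance.elementary N S T) v = φ.value (Instance.elementary N S T) v := by
      intro S T hST
      refine hψ.value_eq_of_follows_id hφ
        ((Instance.deterministic_follows _ _).congr fun X _ => ?_) v
      rw [Instance.elementaryMap]
      split_ifs with h
      · rw [← hST h.2.1 h.2.2.1 h.2.2.2, h.1, id_eq]
      · rfl
    by_cases hc : S.Nonempty ∧ S ⊆ T ∧ T ⊆ N
    swap
    · exact hdeg S T fun h1 h2 h3 => absurd ⟨h1, h2, h3⟩ hc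
    obtain ⟨hS, hST, hT⟩ := hc
    have hf : ∀ X ⊆ N, X ⊆ Instance.criticalMap S T X ∧ Instance.criticalMap S T X ⊆ N := by
      intro X hX
      rw [Instance.criticalMap]
      split_ifs
      · exact ⟨Finset.subset_union_right, Finset.union_subset hT hX⟩
      · exact ⟨subset_rfl, hX⟩
    obtain ⟨K, hK⟩ : ∃ K : Instance V N, K.Follows (Instance.criticalMap S T) :=
      ⟨_, Instance.deterministic_follows hf (if_neg fun h => hS.ne_empty (Finset.subset_empty.1 h))⟩
    have h := hψ.value_sub_value hφ K v
    have hST' : Instance.criticalMap S T S = T := by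
      rw [Instance.criticalMap, if_pos subset_rfl, Finset.union_eq_left.2 hST]
    -- The difference on the critical set instance `K` is zero, and only the `(S, T)` term of its
    -- expansion will survive.
    rw [hψ.value_eq_of_follows_criticalMap hφ hK hS hST hT, sub_self,
      Fintype.sum_eq_single (S, T), hK S (hST.trans hT), if_pos hST'.symm, one_mul] at h
    · exact sub_eq_zero.1 h.symm
    rintro ⟨X, Y⟩ hne
    by_cases hX : X ⊆ N
    swap
    · rw [K.prob_off X Y fun hh => hX hh.1, zero_mul]
    simp only [hK X hX Y]
    split_ifs with hY
    swap
    · rw [zero_mul]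
    subst hY
    rw [one_mul, sub_eq_zero]
    -- A remaining seed set either strictly contains `S`, where induction applies, or activates only
    -- itself in `K`.
    by_cases hSX : S ⊆ X
    · have hSX' : S ⊂ X := by
        refine hSX.ssubset_of_ne ?_
        rintro rfl
        exact hne (by rw [hST'])
      refine ih _ ?_ X _ rfl
      have h1 := Finset.card_lt_card hSX'
      have h2 := Finset.card_le_card hX
      omega
    · exact hdeg _ _ fun _ _ _ => by rw [Instance.criticalMap, if_neg hSX]

/-- At most one centrality measure satisfies the axioms. -/
theorem SatisfiesAxioms.unique [Fintype V] (hψ : SatisfiesAxioms w ψ)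
    (hφ : SatisfiesAxioms w φ) : ψ = φ := by
  ext N I v
  rw [← sub_eq_zero, hψ.value_sub_value hφ]
  exact Finset.sum_eq_zero fun q _ => by rw [hψ.value_elementary hφ, sub_self, mul_zero]

end Uniqueness

end SocialInfluence

theorem mainTheorem8 {V : Type*} [Fintype V] [DecidableEq V] (w : V → ℝ) (hw : ∀ v, 0 ≤ w v)
    (ψ : SocialInfluence.CentralityMeasure V) :
    SocialInfluence.SatisfiesAxioms w ψ ↔ ψ = SocialInfluence.weightedShapley w := by
  constructor
  · exact fun h => h.unique (SocialInfluence.satisfiesAxioms_weightedShapley w)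
  · rintro rfl
    exact SocialInfluence.satisfiesAxioms_weightedShapley w
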